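/- Conventions. For an abelian group $A$ and a connection set $C \subseteq A \setminus \{0\}$ with $-C = C$, the Cayley graph $\mathrm{Cay}(A, C)$ has vertex set $A$, with $x, y$ adjacent if and only if $x - y \in C$. For a prime $p$, a $p$-ary Cayley graph is a Cayley graph on $(\mathbb{Z}/p)^d$ for some $d \ge 0$. A graph is a core if all its endomorphisms are invertible; a core of a graph $X$ is a subgraph that is both a retract of $X$ and a core. $\overline{X}$ denotes the complement of $X$, and $e_1, \dots, e_d$ the standard basis of $(\mathbb{Z}/p)^d$. Let $\kappa(2) = 5$, $\kappa(3) = 12$ and $\kappa(p) = 2$ for primes $p \ge 5$. Statement. For each prime $p$ there exist $d \ge 0$ and a $p$-ary Cayley graph $X_* = \mathrm{Cay}((\mathbb{Z}/p)^{d}, C_*)$ of degree $\kappa(p)$ such that both $X_*$ and $\overline{X_*}$ are cores and neither is complete. In particular $X_*$ is a $p$-ary Cayley graph of degree $\kappa(p)$, and $\overline{X_*} = \mathrm{Cay}((\mathbb{Z}/p)^{d}, (\mathbb{Z}/p)^{d} \setminus (C_* \cup \{0\}))$ is a $p$-ary Cayley graph of degree $p^{d} - \kappa(p) - 1$, and neither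 of them has a complete core. (Hence, in the sufficient condition "$\deg(X) < \kappa(p)$ or $\deg(X) \ge p^d - \kappa(p)$" for a $p$-ary Cayley graph $X$ on $(\mathbb{Z}/p)^d$ to have a complete core, neither of the two bounds can be relaxed by one.) Explicitly, one may take: - for $p = 2$: $d = 4$ and $C_* = \{e_1, e_2, e_3, e_4, e_1 + e_2 + e_3 + e_4\}$; then $X_*$ is isomorphic to the folded $5$-cube (the quotient of the $5$-cube that identifies antipodal vertices) and $\overline{X_*}$ to the halved $5$-cube (binary vectors of length $5$ and even weight, adjacent when they differ in exactly two coordinates); - for $p = 3$: $d = 3$ and $C_* = S \cup (-S)$ with $S = \{e_1, e_2, e_3, e_1 + e_2, e_1 + e_3, e_1 + e_2 + e_3\}$, so that $X_*$ has $27$ vertices; - for $p \ge 5$: $d = 1$ and $C_* = \{e_1, -e_1\}$; then $X_*$ is isomorphic to the $p$-cycle $C_p$ and $\overline{X_*}$ to its complement. -/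

import Mathlib

namespace PAryCayley

/-- A connection set in an additive abelian group `A`: a subset `C` of `A \ {0}` with `-C = C`.
The Cayley graph `Cay(A, C)` is Mathlib's `SimpleGraph.addCayley C`; for a connection set its
adjacency is `x - y ∈ C`, see `addCayley_adj_iff`. -/
def IsConnectionSet {A : Type*} [AddCommGroup A] (C : Set A) : Prop :=
  (0 : A) ∉ C ∧ -C = C

theorem addCayley_adj_iff {A : Type*} [AddCommGroup A] {C : Set A} (hC : IsConnectionSet C)
    (x y : A) : (SimpleGraph.addCayley C).Adj x y ↔ x - y ∈ C := by
  obtain ⟨h0, hneg⟩ := hC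
  have hsymm : ∀ a : A, -a ∈ C ↔ a ∈ C := by
    intro a
    rw [← Set.mem_neg, hneg]
  have h1 : -x + y ∈ C ↔ x - y ∈ C := by
    rw [← hsymm (x - y)]
    have : -(x - y) = -x + y := by abel
    rw [this]
  have h2 : -y + x = x - y := by abel
  rw [SimpleGraph.addCayley_adj, h1, h2, or_self]
  refine ⟨fun h => h.2, fun h => ⟨?_, h⟩⟩
  rintro rfl
  rw [sub_self] at h
  exact h0 h

/-- A graph is a core if all its endomorphisms are invertible. -/
def IsCore {V : Type*} (X : SimpleGraph V) : Prop :=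
  ∀ f : X →g X, ∃ g : X →g X, (∀ v, g (f v) = v) ∧ ∀ v, f (g v) = v

/-- The subgraph `H` is a retract of `X`: some homomorphism from `X` to `H` fixes the vertices
of `H`. -/
def IsRetract {V : Type*} {X : SimpleGraph V} (H : X.Subgraph) : Prop :=
  ∃ r : X →g H.coe, ∀ v : H.verts, r v = v

/-- The subgraph `H` is a core of `X`: it is a retract of `X` and it is a core. -/
def IsCoreOf {V : Type*} {X : SimpleGraph V} (H : X.Subgraph) : Prop :=
  IsRetract H ∧ IsCore H.coe

/-- `X` has a complete core. -/
def HasCompleteCore {V : Type*} (X : SimpleGraph V) : Prop :=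
  ∃ H : X.Subgraph, IsCoreOf H ∧ H.coe = ⊤

open Classical in
/-- Every vertex of the finite graph `X` has degree `k`. -/
def HasDegree {V : Type*} [Fintype V] (X : SimpleGraph V) (k : ℕ) : Prop :=
  X.IsRegularOfDegree k

/-- The function `κ`; its values matter only at primes. -/
def kappa (p : ℕ) : ℕ :=
  if p = 2 then 5 else if p = 3 then 12 else 2

/-- The graph `X = Cay((ℤ/p)^d, C)` and its complement `Xᶜ` are `p`-ary Cayley graphs, of degrees
`κ(p)` and `p^d - κ(p) - 1` respectively; both are cores, neither is complete, and neither has a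
complete core. -/
structure IsSharpExample (p : ℕ) [Fact p.Prime] (d : ℕ) (C : Set (Fin d → ZMod p)) : Prop where
  connectionSet : IsConnectionSet C
  compl_connectionSet : IsConnectionSet (C ∪ {0})ᶜ
  compl_eq : (SimpleGraph.addCayley C)ᶜ = SimpleGraph.addCayley (C ∪ {0})ᶜ
  degree : HasDegree (SimpleGraph.addCayley C) (kappa p)
  compl_degree : HasDegree (SimpleGraph.addCayley C)ᶜ (p ^ d - kappa p - 1)
  isCore : IsCore (SimpleGraph.addCayley C)
  compl_isCore : IsCore (SimpleGraph.addCayley C)ᶜ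
  ne_top : SimpleGraph.addCayley C ≠ ⊤
  compl_ne_top : (SimpleGraph.addCayley C)ᶜ ≠ ⊤
  no_completeCore : ¬ HasCompleteCore (SimpleGraph.addCayley C)
  compl_no_completeCore : ¬ HasCompleteCore (SimpleGraph.addCayley C)ᶜ

/-- The `i`-th standard basis vector of `(ℤ/p)^d`. -/
def e (p : ℕ) {d : ℕ} (i : Fin d) : Fin d → ZMod p :=
  Pi.single i 1

/-- `{i, j, k, ℓ, i + j + k + ℓ}` in `(ℤ/2)^4`. -/
def connTwo : Set (Fin 4 → ZMod 2) :=
  {e 2 0, e 2 1, e 2 2, e 2 3, e 2 0 + e 2 1 + e 2 2 + e 2 3}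

/-- `{i, j, k, i + j, i + k, i + j + k}` in `(ℤ/3)^3`. -/
def repThree : Set (Fin 3 → ZMod 3) :=
  {e 3 0, e 3 1, e 3 2, e 3 0 + e 3 1, e 3 0 + e 3 2, e 3 0 + e 3 1 + e 3 2}

/-- The vectors of `(ℤ/3)^3` whose class `[v] = {v, -v}` is the class of a vector of `repThree`. -/
def connThree : Set (Fin 3 → ZMod 3) :=
  repThree ∪ -repThree

/-- `{i, -i}` in `(ℤ/p)^1`. -/
def connCycle (p : ℕ) : Set (Fin 1 → ZMod p) :=
  {e p 0, -e p 0}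

/-- The `n`-cube: binary vectors of length `n`, adjacent when they differ in one coordinate. -/
def cube (n : ℕ) : SimpleGraph (Fin n → ZMod 2) where
  Adj x y := hammingDist x y = 1
  symm := ⟨fun x y h => by rw [hammingDist_comm]; exact h⟩
  loopless := ⟨fun x h => by simp at h⟩

/-- The subgroup `{0, (1, …, 1)}`, whose cosets are the pairs of antipodal vertices of the cube. -/
def antipodal (n : ℕ) : AddSubgroup (Fin n → ZMod 2) :=
  AddSubgroup.zmultiples 1

/-- The folded `n`-cube: the quotient of the `n`-cube that identifies antipodal vertices. -/
def foldedCube (n : ℕ) : SimpleGraph ((Fin n → ZMod 2) ⧸ antipodal n) :=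
  (cube n).map (QuotientAddGroup.mk : (Fin n → ZMod 2) → (Fin n → ZMod 2) ⧸ antipodal n)

/-- The halved `n`-cube: binary vectors of length `n` and of even weight, adjacent when they
differ in exactly two coordinates. -/
def halvedCube (n : ℕ) : SimpleGraph {x : Fin n → ZMod 2 // ∑ i, x i = 0} where
  Adj x y := hammingDist x.1 y.1 = 2
  symm := ⟨fun x y h => by rw [hammingDist_comm]; exact h⟩
  loopless := ⟨fun x h => by simp at h⟩

end PAryCayley

/-! A finite graph is a core once all its endomorphisms are injective, and a core with a complete
core must itself be complete (`IsCore.not_hasCompleteCore`). So it is enough to show that each graph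
and its complement have only injective endomorphisms.

In a Cayley graph, translation reduces this to endomorphisms fixing 0: none may send some `c ≠ 0` to
0 (`isCore_addCayley`). For `p = 2, 3` a backtracking search, run in the kernel, excludes each `c`;
its soundness is `isCore_addCayley_of_refutes`.

For `p ≥ 5` the odd cycle is a core because it has no shorter odd closed walk (`walk_ne_of_odd`).
Its complement is a core by pigeonhole: an endomorphism missing a vertex would cover the cycle's `p`
vertices by `(p - 1) / 2` cliques, and the cycle has no triangle. -/

namespace PAryCayley

open SimpleGraph

/-! ### Cores of finite graphs. -/

section General

variable {V : Type*} {X : SimpleGraph V}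

/-- An injective `f` is a permutation of some finite order `k`, so its inverse is the homomorphism
`f^[k - 1]`. -/
theorem isCore_of_forall_injective [Finite V] (h : ∀ f : X →g X, Function.Injective f) :
    IsCore X := by
  intro f
  have hpow : ∀ k : ℕ, ∀ x y, X.Adj x y → X.Adj (f^[k] x) (f^[k] y) := by
    intro k
    induction k with
    | zero => exact fun x y hxy => hxy
    | succ k ih =>
      intro x y hxy
      exact ih _ _ (f.map_adj hxy)
  have hbij : Function.Bijective f := Finite.injective_iff_bijective.mp (h f)
  let σ : Equiv.Perm V := Equiv.ofBijective f hbij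
  obtain ⟨k, hk, hσ⟩ := (isOfFinOrder_of_finite σ).exists_pow_eq_one
  have hiter : ∀ v, f^[k] v = v := by
    intro v
    have := congrArg (fun τ : Equiv.Perm V => τ v) hσ
    change (⇑σ)^[k] v = v
    simpa [Equiv.Perm.coe_pow] using this
  obtain ⟨m, rfl⟩ : ∃ m, k = m + 1 := ⟨k - 1, by omega⟩
  refine ⟨⟨f^[m], fun {x y} hxy => hpow m x y hxy⟩, fun v => ?_, fun v => ?_⟩
  · exact hiter v
  · have := hiter v
    rwa [Function.iterate_succ_apply'] at this

/-- The retraction onto `H`, viewed as an endomorphism of `X`, is invertible; hence `H` has all the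
vertices of `X`. -/
theorem IsCore.not_hasCompleteCore (hX : IsCore X) (hne : X ≠ ⊤) : ¬ HasCompleteCore X := by
  rintro ⟨H, ⟨⟨r, -⟩, -⟩, htop⟩
  obtain ⟨g, -, hg⟩ := hX (H.hom.comp r)
  refine hne (eq_top_iff.mpr fun x y hxy => ?_)
  have hmem : ∀ v, v ∈ H.verts := fun v => by
    have := hg v
    rw [← this]
    exact (r (g v)).2
  have : H.coe.Adj ⟨x, hmem x⟩ ⟨y, hmem y⟩ := by
    rw [htop]
    simpa [Subtype.ext_iff] using hxy
  exact H.adj_sub this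

end General

/-! ### Cayley graphs and their complements. -/

section Cayley

variable {A : Type*} [AddCommGroup A] {C : Set A}

theorem IsConnectionSet.compl (hC : IsConnectionSet C) : IsConnectionSet (C ∪ {0})ᶜ := by
  refine ⟨by simp, ?_⟩
  ext a
  rw [Set.mem_neg, Set.mem_compl_iff, Set.mem_compl_iff, Set.mem_union, Set.mem_union,
    ← Set.mem_neg, hC.2]
  simp

theorem addCayley_compl (hC : IsConnectionSet C) :
    (addCayley C)ᶜ = addCayley (C ∪ {0})ᶜ := by
  ext x y
  rw [compl_adj, addCayley_adj_iff hC, addCayley_adj_iff hC.compl]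
  simp [sub_eq_zero, not_or]

theorem addCayley_ne_top {a : A} (hC : IsConnectionSet C) (ha : a ≠ 0) (haC : a ∉ C) :
    addCayley C ≠ ⊤ := by
  intro h
  have : (addCayley C).Adj a 0 := by rw [h]; exact ha
  rw [addCayley_adj_iff hC, sub_zero] at this
  exact haC this

theorem addCayley_compl_ne_top {a : A} (hC : IsConnectionSet C) (haC : a ∈ C) :
    (addCayley C)ᶜ ≠ ⊤ := by
  rw [addCayley_compl hC]
  refine addCayley_ne_top (a := a) hC.compl ?_ (by simp [haC])
  rintro rfl
  exact hC.1 haC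

theorem hasDegree_addCayley [Fintype A] (hC : IsConnectionSet C) :
    HasDegree (addCayley C) C.ncard := by
  classical
  intro v
  rw [degree, ← Set.ncard_coe_finset, coe_neighborFinset]
  have : (addCayley C).neighborSet v = (fun c => v - c) '' C := by
    ext w
    rw [mem_neighborSet, addCayley_adj_iff hC]
    constructor
    · exact fun h => ⟨v - w, h, sub_sub_cancel v w⟩
    · rintro ⟨c, hc, rfl⟩
      simpa using hc
  rw [this, Set.ncard_image_of_injective _ sub_right_injective]

theorem hasDegree_compl {V : Type*} [Fintype V] {X : SimpleGraph V} {k : ℕ} (h : HasDegree X k) :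
    HasDegree Xᶜ (Fintype.card V - k - 1) := by
  classical
  unfold HasDegree at h ⊢
  have := IsRegularOfDegree.compl h
  rw [Nat.sub_right_comm]
  convert this

/-- By translation, an endomorphism of a Cayley graph that is not injective may be taken to
identify some nonzero element with `0`, and to fix `0`. -/
theorem isCore_addCayley [Finite A] (hC : IsConnectionSet C)
    (h : ∀ f : addCayley C →g addCayley C, f 0 = 0 → ∀ c, c ≠ 0 → f c ≠ 0) :
    IsCore (addCayley C) := by
  refine isCore_of_forall_injective fun f x y hxy => ?_
  by_contra hne
  let f' : addCayley C →g addCayley C :=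
    ⟨fun v => f (v + x) - f x, fun {a b} hab => by
      have := f.map_adj (show (addCayley C).Adj (a + x) (b + x) by
        rw [addCayley_adj_iff hC] at hab ⊢
        simpa using hab)
      rw [addCayley_adj_iff hC] at this ⊢
      simpa using this⟩
  refine h f' ?_ (y - x) (sub_ne_zero.mpr (Ne.symm hne)) ?_
  · change f (0 + x) - f x = 0
    simp
  · change f (y - x + x) - f x = 0
    simp [hxy]

theorem isSharpExample_of_isCore {p : ℕ} [Fact p.Prime] {d : ℕ} {C : Set (Fin d → ZMod p)}
    (hC : IsConnectionSet C) (hcard : C.ncard = kappa p) {a b : Fin d → ZMod p} (ha : a ∈ C)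
    (hb : b ≠ 0) (hbC : b ∉ C) (hcore : IsCore (addCayley C)) (hcore' : IsCore (addCayley C)ᶜ) :
    IsSharpExample p d C where
  connectionSet := hC
  compl_connectionSet := hC.compl
  compl_eq := addCayley_compl hC
  degree := hcard ▸ hasDegree_addCayley hC
  compl_degree := by
    have := hasDegree_compl (hcard ▸ hasDegree_addCayley hC)
    simpa [ZMod.card] using this
  isCore := hcore
  compl_isCore := hcore'
  ne_top := addCayley_ne_top hC hb hbC
  compl_ne_top := addCayley_compl_ne_top hC ha
  no_completeCore := hcore.not_hasCompleteCore (addCayley_ne_top hC hb hbC)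
  compl_no_completeCore := hcore'.not_hasCompleteCore (addCayley_compl_ne_top hC ha)

end Cayley

/-! ### Soundness of the backtracking search. -/

section Search

/-- The vertices `t` that may still be the image of `v`, as a bit mask, when a partial assignment
is given and `row` lists the neighbourhoods of the graph as bit masks. -/
def candidates (row : ℕ → ℕ) (n v : ℕ) (asg : List (ℕ × ℕ)) : ℕ :=
  asg.foldl (fun m a => bif (row v).testBit a.1 then m &&& row a.2 else m) (2 ^ n - 1)

/-- Backtracking search: no endomorphism extends the partial assignment to the listed vertices. -/
def refutes (row : ℕ → ℕ) (n : ℕ) : List ℕ → List (ℕ × ℕ) → Bool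
  | [], _ => false
  | v :: vs, asg =>
    Nat.beq (candidates row n v asg) 0 ||
      (List.range n).all fun t =>
        !(candidates row n v asg).testBit t || refutes row n vs ((v, t) :: asg)

variable {row : ℕ → ℕ} {n : ℕ} {F : ℕ → ℕ}

theorem testBit_candidates
    (hF : ∀ v w, v < n → w < n → (row v).testBit w → (row (F w)).testBit (F v))
    {v : ℕ} (hv : v < n) (hvF : F v < n) {asg : List (ℕ × ℕ)}
    (hasg : ∀ a ∈ asg, a.1 < n ∧ F a.1 = a.2) :
    (candidates row n v asg).testBit (F v) := by
  suffices h : ∀ m : ℕ, m.testBit (F v) →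
      (asg.foldl (fun m a => bif (row v).testBit a.1 then m &&& row a.2 else m) m).testBit (F v) by
    exact h _ (by simp [Nat.testBit_two_pow_sub_one, hvF])
  induction asg with
  | nil => exact fun m hm => hm
  | cons a asg ih =>
    intro m hm
    rw [List.foldl_cons]
    apply ih (fun b hb => hasg b (List.mem_cons_of_mem _ hb))
    cases hadj : (row v).testBit a.1
    · exact hm
    · obtain ⟨ha, haF⟩ := hasg a List.mem_cons_self
      rw [cond_true, Nat.testBit_and, hm, ← haF, hF v a.1 hv ha hadj]
      rfl

/-- An actual endomorphism `F` survives the search: the branch `t = F v` is never pruned. -/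
theorem refutes_eq_false
    (hF : ∀ v w, v < n → w < n → (row v).testBit w → (row (F w)).testBit (F v))
    (hFn : ∀ v, v < n → F v < n) {vs : List ℕ} (hvs : ∀ v ∈ vs, v < n) {asg : List (ℕ × ℕ)}
    (hasg : ∀ a ∈ asg, a.1 < n ∧ F a.1 = a.2) : refutes row n vs asg = false := by
  induction vs generalizing asg with
  | nil => rfl
  | cons v vs ih =>
    have hv := hvs v List.mem_cons_self
    have hbit := testBit_candidates hF hv (hFn v hv) hasg
    rw [refutes, Bool.or_eq_false_iff, List.all_eq_false]
    refine ⟨?_, F v, List.mem_range.mpr (hFn v hv), ?_⟩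
    · refine Bool.eq_false_iff.mpr fun h => ?_
      rw [Nat.eq_of_beq_eq_true h, Nat.zero_testBit] at hbit
      exact Bool.false_ne_true hbit
    rw [hbit, ih (fun w hw => hvs w (List.mem_cons_of_mem _ hw))]
    · simp
    · intro a ha
      rcases List.mem_cons.mp ha with rfl | ha
      · exact ⟨hv, rfl⟩
      · exact hasg a ha

/-- The list `vs c` is a certificate: a few vertices, in a suitable order, already contradict `c ↦
0`, `0 ↦ 0`. If `c` is adjacent to 0, looplessness suffices. -/
theorem isCore_addCayley_of_refutes {A : Type*} [AddCommGroup A] {C : Set A}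
    (hC : IsConnectionSet C) {n : ℕ} [NeZero n] (φ : Fin n ≃ A) (hφ : φ 0 = 0) (row : ℕ → ℕ)
    (hrow : ∀ i j : Fin n, (row i).testBit j = true ↔ φ i - φ j ∈ C) (vs : ℕ → List ℕ)
    (hvs : ∀ c < n, ∀ v ∈ vs c, v < n)
    (h : ∀ c < n, c ≠ 0 → (row c).testBit 0 = true ∨
      refutes row n (vs c) [(c, 0), (0, 0)] = true) :
    IsCore (addCayley C) := by
  have : Finite A := Finite.of_equiv _ φ
  refine isCore_addCayley hC fun f hf0 c hc hfc => ?_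
  let F : ℕ → ℕ := fun v => if hv : v < n then (φ.symm (f (φ ⟨v, hv⟩)) : Fin n) else 0
  have hF (i : Fin n) : F i = (φ.symm (f (φ i)) : Fin n) := by simp [F]
  have hn : 0 < n := Nat.pos_of_ne_zero (NeZero.ne n)
  have hsymm0 : φ.symm 0 = 0 := by rw [← hφ, φ.symm_apply_apply]
  have hF0 : F 0 = 0 := by
    have := hF 0
    rw [hφ, hf0, hsymm0] at this
    simpa using this
  have hFc : F (φ.symm c : Fin n) = 0 := by
    rw [hF, φ.apply_symm_apply, hfc, hsymm0]
    simp
  have hc0 : ((φ.symm c : Fin n) : ℕ) ≠ 0 := by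
    intro h0
    apply hc
    rw [← φ.apply_symm_apply c, ← hφ]
    congr 1
    exact Fin.ext (by simpa using h0)
  rcases h (φ.symm c : Fin n) (Fin.is_lt _) hc0 with hadj | hr
  · have h1 := (hrow (φ.symm c) 0).mp (by simpa using hadj)
    rw [φ.apply_symm_apply, hφ, ← addCayley_adj_iff hC] at h1
    exact (f.map_adj h1).ne (by rw [hfc, hf0])
  · rw [refutes_eq_false (F := F)] at hr
    · exact Bool.false_ne_true hr
    · intro v w hv hw hvw
      have h1 := (hrow ⟨v, hv⟩ ⟨w, hw⟩).mp hvw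
      rw [← addCayley_adj_iff hC] at h1
      have h2 := (f.map_adj h1).symm
      rw [addCayley_adj_iff hC] at h2
      have h3 := (hrow (φ.symm (f (φ ⟨w, hw⟩))) (φ.symm (f (φ ⟨v, hv⟩)))).mpr (by simpa using h2)
      simpa only [F, dif_pos hv, dif_pos hw] using h3
    · intro v hv
      simp only [F, dif_pos hv, Fin.is_lt]
    · exact hvs _ (Fin.is_lt _)
    · intro a ha
      simp only [List.mem_cons, List.not_mem_nil, or_false] at ha
      rcases ha with rfl | rfl
      · exact ⟨Fin.is_lt _, hFc⟩
      · exact ⟨hn, hF0⟩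

end Search

/-! ### The example for `p = 3`. -/

section Three

/-- The elements of `connThree`. -/
def connThreeFinset : Finset (Fin 3 → ZMod 3) :=
  {![1, 0, 0], ![0, 1, 0], ![0, 0, 1], ![1, 1, 0], ![1, 0, 1], ![1, 1, 1],
    ![2, 0, 0], ![0, 2, 0], ![0, 0, 2], ![2, 2, 0], ![2, 0, 2], ![2, 2, 2]}

theorem coe_connThreeFinset : (connThreeFinset : Set (Fin 3 → ZMod 3)) = connThree := by
  have h : ∀ x : Fin 3 → ZMod 3, x ∈ connThreeFinset ↔
      ((x = e 3 0 ∨ x = e 3 1 ∨ x = e 3 2 ∨ x = e 3 0 + e 3 1 ∨ x = e 3 0 + e 3 2 ∨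
        x = e 3 0 + e 3 1 + e 3 2) ∨
      (-x = e 3 0 ∨ -x = e 3 1 ∨ -x = e 3 2 ∨ -x = e 3 0 + e 3 1 ∨ -x = e 3 0 + e 3 2 ∨
        -x = e 3 0 + e 3 1 + e 3 2)) := by
    unfold e
    decide +kernel
  ext x
  rw [Finset.mem_coe, h]
  rfl

theorem isConnectionSet_connThree : IsConnectionSet connThree := by
  rw [← coe_connThreeFinset]
  have h : ∀ x : Fin 3 → ZMod 3, -x ∈ connThreeFinset ↔ x ∈ connThreeFinset := by
    decide +kernel
  exact ⟨by rw [Finset.mem_coe]; decide +kernel, Set.ext fun x => h x⟩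

theorem ncard_connThree : connThree.ncard = 12 := by
  rw [← coe_connThreeFinset, Set.ncard_coe_finset]
  decide +kernel

/-- The neighbourhoods of `Cay((ℤ/3)^3, connThree)` as bit masks. -/
def rowThree (v : ℕ) : ℕ :=
  1355650676204330625990809070411071816837564202588644618905506855739186386596612619743745440604345806579922785688297149539707668177698081577649722918761257696833745281455559311418343939910245301702169198998766318152591198 >>> (27 * v)

/-- The neighbourhoods of the complement of `Cay((ℤ/3)^3, connThree)` as bit masks. -/
def complRowThree (v : ℕ) : ℕ :=
  56356297889642201339838527821832330268805648671417494451659774085483812084868005284629114554760683416530166684672361589854135910679221232099503391084987373798379428744493127591684057983214381468089352312091911341725856 >>> (27 * v)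

/-- Vertices of `Cay((ℤ/3)^3, connThree)` to which no endomorphism
that identifies `c` with `0` extends, for `c ≠ 0` not adjacent to `0`. -/
def orderThree (c : ℕ) : List ℕ :=
  [[], [], [], [], [], [23, 19, 20, 10], [], [16, 25, 26, 20], [], [], [], [12, 13, 16, 3],
    [21, 18, 11, 20], [], [17, 18, 9, 11], [4, 17, 14, 13], [9, 11, 12, 2], [6, 16, 15, 10], [],
    [26, 24, 6, 23], [], [23, 3, 6, 20, 7, 2], [10, 9, 13, 12, 2, 19], [19, 1, 18, 24],
    [8, 7, 25, 2], [19, 10, 9, 15], []].getD c []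

theorem isCore_connThree : IsCore (addCayley connThree) := by
  refine isCore_addCayley_of_refutes isConnectionSet_connThree
    (finFunctionFinEquiv (m := 3) (n := 3)).symm (by decide +kernel) rowThree ?_ orderThree
    (by decide +kernel) (by decide +kernel)
  -- Vertices are numbered by their base-3 digits. The shifted constant keeps the later rows in its
  -- bits from 27 on, but only bits below 27 are compared.
  simp only [← coe_connThreeFinset, Finset.mem_coe]
  decide +kernel

/-- Vertices of the complement of `Cay((ℤ/3)^3, connThree)` to which no endomorphism
that identifies `c` with `0` extends, for `c ≠ 0` not adjacent to `0`. -/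
def complOrderThree (c : ℕ) : List ℕ :=
  [[], [13, 24, 5, 11], [23, 4, 25, 11], [18, 23, 16, 8], [9, 6, 20, 14], [], [4, 24, 16, 9], [],
    [3, 17, 10, 25], [20, 22, 14, 6], [18, 25, 14, 3], [], [], [16, 2, 18, 23], [], [], [], [],
    [16, 8, 19, 21], [], [15, 21, 13, 1], [], [], [], [], [], [16, 22, 2, 14]].getD c []

theorem isCore_compl_connThree : IsCore (addCayley connThree)ᶜ := by
  rw [addCayley_compl isConnectionSet_connThree]
  refine isCore_addCayley_of_refutes isConnectionSet_connThree.compl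
    (finFunctionFinEquiv (m := 3) (n := 3)).symm (by decide +kernel) complRowThree ?_
    complOrderThree (by decide +kernel) (by decide +kernel)
  simp only [← coe_connThreeFinset, Finset.mem_coe, Set.mem_compl_iff, Set.mem_union,
    Set.mem_singleton_iff]
  decide +kernel

theorem isSharpExample_three : IsSharpExample 3 3 connThree := by
  refine isSharpExample_of_isCore (a := ![1, 0, 0]) (b := ![0, 1, 2]) isConnectionSet_connThree
    ncard_connThree ?_ (by decide +kernel) ?_ isCore_connThree isCore_compl_connThree
  all_goals
    rw [← coe_connThreeFinset, Finset.mem_coe]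
    decide +kernel

end Three

/-! ### The example for `p = 2`. -/

section Two

/-- The elements of `connTwo`. -/
def connTwoFinset : Finset (Fin 4 → ZMod 2) :=
  {![1, 0, 0, 0], ![0, 1, 0, 0], ![0, 0, 1, 0], ![0, 0, 0, 1], ![1, 1, 1, 1]}

theorem coe_connTwoFinset : (connTwoFinset : Set (Fin 4 → ZMod 2)) = connTwo := by
  have h : ∀ x : Fin 4 → ZMod 2, x ∈ connTwoFinset ↔
      (x = e 2 0 ∨ x = e 2 1 ∨ x = e 2 2 ∨ x = e 2 3 ∨ x = e 2 0 + e 2 1 + e 2 2 + e 2 3) := by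
    unfold e
    decide +kernel
  ext x
  rw [Finset.mem_coe, h]
  rfl

theorem isConnectionSet_connTwo : IsConnectionSet connTwo := by
  rw [← coe_connTwoFinset]
  have h : ∀ x : Fin 4 → ZMod 2, -x ∈ connTwoFinset ↔ x ∈ connTwoFinset := by
    decide +kernel
  exact ⟨by rw [Finset.mem_coe]; decide +kernel, Set.ext fun x => h x⟩

theorem ncard_connTwo : connTwo.ncard = 5 := by
  rw [← coe_connTwoFinset, Set.ncard_coe_finset]
  decide +kernel

/-- The neighbourhoods of `Cay((ℤ/2)^4, connTwo)` as bit masks. -/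
def rowTwo (v : ℕ) : ℕ :=
  47269482777222481156278696261198368824595748466551660426417626091428187308310 >>> (16 * v)

/-- The neighbourhoods of the complement of `Cay((ℤ/2)^4, connTwo)` as bit masks. -/
def complRowTwo (v : ℕ) : ℕ :=
  10626120126299402914825701374772685345770300812562364524378909892569698959080 >>> (16 * v)

/-- Vertices of `Cay((ℤ/2)^4, connTwo)` to which no endomorphism
that identifies `c` with `0` extends, for `c ≠ 0` not adjacent to `0`. -/
def orderTwo (c : ℕ) : List ℕ :=
  [[], [], [], [8, 12], [], [13, 2], [15, 14], [1, 3], [], [6, 4], [11, 4], [9, 8], [3, 1],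
    [12, 8], [12, 4], []].getD c []

theorem isCore_connTwo : IsCore (addCayley connTwo) := by
  refine isCore_addCayley_of_refutes isConnectionSet_connTwo
    (finFunctionFinEquiv (m := 2) (n := 4)).symm (by decide +kernel) rowTwo ?_ orderTwo
    (by decide +kernel) (by decide +kernel)
  simp only [← coe_connTwoFinset, Finset.mem_coe]
  decide +kernel

/-- Vertices of the complement of `Cay((ℤ/2)^4, connTwo)` to which no endomorphism
that identifies `c` with `0` extends, for `c ≠ 0` not adjacent to `0`. -/
def complOrderTwo (c : ℕ) : List ℕ :=
  [[], [5, 2, 9, 15, 12], [8, 13, 14, 4, 3], [], [15, 8, 3, 5, 6], [], [], [], [5, 9, 15, 2, 12],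
    [], [], [], [], [], [], [8, 2, 14, 5, 11]].getD c []

theorem isCore_compl_connTwo : IsCore (addCayley connTwo)ᶜ := by
  rw [addCayley_compl isConnectionSet_connTwo]
  refine isCore_addCayley_of_refutes isConnectionSet_connTwo.compl
    (finFunctionFinEquiv (m := 2) (n := 4)).symm (by decide +kernel) complRowTwo ?_ complOrderTwo
    (by decide +kernel) (by decide +kernel)
  simp only [← coe_connTwoFinset, Finset.mem_coe, Set.mem_compl_iff, Set.mem_union,
    Set.mem_singleton_iff]
  decide +kernel

theorem isSharpExample_two : IsSharpExample 2 4 connTwo := by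
  refine isSharpExample_of_isCore (a := ![1, 0, 0, 0]) (b := ![1, 1, 0, 0])
    isConnectionSet_connTwo ncard_connTwo ?_ (by decide +kernel) ?_ isCore_connTwo
    isCore_compl_connTwo
  all_goals
    rw [← coe_connTwoFinset, Finset.mem_coe]
    decide +kernel

end Two

/-! ### The folded and the halved 5-cube. -/

section Cubes

/-- The linear bijection `e_i ↦ e_i + (1, …, 1)` from `(ℤ/2)^4` to the even vectors of
`(ℤ/2)^5`. -/
def evenEquiv : (Fin 4 → ZMod 2) ≃ {x : Fin 5 → ZMod 2 // ∑ i, x i = 0} where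
  toFun x := ⟨Fin.snoc (fun i => x i + ∑ j, x j) (∑ j, x j), by revert x; decide +kernel⟩
  invFun y := fun i => y.1 i.castSucc + y.1 (Fin.last 4)
  left_inv := by unfold Function.LeftInverse; decide +kernel
  right_inv := by unfold Function.RightInverse Function.LeftInverse; decide +kernel

/-- `evenEquiv` carries `connTwo` onto the five vectors of weight 4, so the nonzero elements outside
it become the vectors of weight 2. -/
theorem nonempty_iso_halvedCube : Nonempty ((addCayley connTwo)ᶜ ≃g halvedCube 5) := by
  rw [addCayley_compl isConnectionSet_connTwo]
  refine ⟨⟨evenEquiv, fun {x y} => ?_⟩⟩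
  rw [addCayley_adj_iff isConnectionSet_connTwo.compl, ← coe_connTwoFinset]
  simp only [Set.mem_compl_iff, Set.mem_union, Finset.mem_coe, Set.mem_singleton_iff]
  change hammingDist (evenEquiv x).1 (evenEquiv y).1 = 2 ↔ _
  revert x y
  decide +kernel

theorem mem_antipodal {n : ℕ} {x : Fin n → ZMod 2} : x ∈ antipodal n ↔ x = 0 ∨ x = 1 := by
  rw [antipodal, AddSubgroup.mem_zmultiples_iff]
  constructor
  · rintro ⟨k, rfl⟩
    have h : ∀ a : ZMod 2, a = 0 ∨ a = 1 := by decide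
    rcases h k with hk | hk
    · left
      ext i
      simp [hk]
    · right
      ext i
      simp [hk]
  · rintro (rfl | rfl)
    · exact ⟨0, zero_smul _ _⟩
    · exact ⟨1, one_smul _ _⟩

theorem mk_antipodal_eq {n : ℕ} {x y : Fin n → ZMod 2} :
    (QuotientAddGroup.mk x : (Fin n → ZMod 2) ⧸ antipodal n) = QuotientAddGroup.mk y ↔
      y = x ∨ y = x + 1 := by
  rw [QuotientAddGroup.eq, mem_antipodal, neg_add_eq_zero, neg_add_eq_iff_eq_add, eq_comm]

/-- Every coset of `{0, (1, …, 1)}` has a unique representative with last coordinate `0`. -/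
noncomputable def foldEquiv : (Fin 4 → ZMod 2) ≃ (Fin 5 → ZMod 2) ⧸ antipodal 5 :=
  Equiv.ofBijective (fun x => QuotientAddGroup.mk (Fin.snoc x 0)) <| by
    constructor
    · intro x y hxy
      have h := mk_antipodal_eq.mp hxy
      clear hxy
      revert x y
      decide +kernel
    · intro q
      obtain ⟨y, rfl⟩ := QuotientAddGroup.mk_surjective q
      refine ⟨fun i => y i.castSucc + y (Fin.last 4), mk_antipodal_eq.mpr ?_⟩
      revert y
      decide +kernel

/-- Adding the all-ones vector to both ends preserves distance, so only the representative of one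
end has to vary. -/
theorem foldedCube_adj_mk {n : ℕ} (x y : Fin n → ZMod 2) :
    (foldedCube n).Adj (QuotientAddGroup.mk x) (QuotientAddGroup.mk y) ↔
      ¬ (y = x ∨ y = x + 1) ∧ (hammingDist x y = 1 ∨ hammingDist x (y + 1) = 1) := by
  have hadd : ∀ a b : Fin n → ZMod 2, hammingDist (a + 1) b = hammingDist a (b + 1) := by
    have h : ∀ a b : ZMod 2, (a + 1 ≠ b) = (a ≠ b + 1) := by decide
    intro a b
    simp only [hammingDist, Pi.add_apply, Pi.one_apply, h]
  have hone : ∀ b : Fin n → ZMod 2, b + 1 + 1 = b := by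
    have h : ∀ b : ZMod 2, b + 1 + 1 = b := by decide
    exact fun b => funext fun i => h (b i)
  rw [foldedCube, SimpleGraph.map_adj', Ne, mk_antipodal_eq]
  refine and_congr_right fun _ => ⟨?_, ?_⟩
  · rintro ⟨a, b, hab, ha, hb⟩
    change hammingDist a b = 1 at hab
    rw [mk_antipodal_eq] at ha hb
    rcases ha with rfl | rfl <;> rcases hb with rfl | rfl
    · exact Or.inl hab
    · exact Or.inr (by rwa [hone])
    · exact Or.inr (by rwa [hadd, hone])
    · exact Or.inl (by rwa [hadd, hone])
  · rintro (h | h)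
    · exact ⟨x, y, h, rfl, rfl⟩
    · exact ⟨x, y + 1, h, rfl, mk_antipodal_eq.mpr (Or.inr (hone y).symm)⟩

/-- Modulo the all-ones vector, flipping the fifth coordinate amounts to flipping the other four,
which accounts for the fifth generator. -/
theorem nonempty_iso_foldedCube : Nonempty (addCayley connTwo ≃g foldedCube 5) := by
  refine ⟨⟨foldEquiv, fun {x y} => ?_⟩⟩
  rw [addCayley_adj_iff isConnectionSet_connTwo, ← coe_connTwoFinset, Finset.mem_coe]
  refine (foldedCube_adj_mk (Fin.snoc x 0) (Fin.snoc y 0)).trans ?_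
  revert x y
  decide +kernel

end Cubes

/-! ### Odd cycles and their complements, for `p ≥ 5`. -/

section Cycle

variable {p : ℕ}

theorem mem_connCycle {x : Fin 1 → ZMod p} : x ∈ connCycle p ↔ x 0 = 1 ∨ x 0 = -1 := by
  simp [connCycle, e, funext_iff]

theorem isConnectionSet_connCycle [Fact (1 < p)] : IsConnectionSet (connCycle p) := by
  refine ⟨by simp [mem_connCycle], Set.ext fun x => ?_⟩
  rw [Set.mem_neg, mem_connCycle, mem_connCycle, Pi.neg_apply, neg_inj, neg_eq_iff_eq_neg, or_comm]

theorem one_ne_neg_one_zmod (hp : 2 < p) : (1 : ZMod p) ≠ -1 := by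
  have := Fact.mk hp
  exact (ZMod.neg_one_ne_one).symm

theorem ncard_connCycle (hp : 2 < p) : (connCycle p).ncard = 2 := by
  refine Set.ncard_pair fun h => one_ne_neg_one_zmod hp ?_
  simpa [e] using congrFun h 0

/-- A walk of length `m` in the cycle `ℤ/p` lifts to a walk in `ℤ`. -/
theorem exists_lift_walk {w : ℕ → ZMod p} (hw : ∀ i, w (i + 1) - w i = 1 ∨ w (i + 1) - w i = -1)
    (m : ℕ) : ∃ s : ℤ, |s| ≤ m ∧ (2 : ℤ) ∣ s - m ∧ (s : ZMod p) = w m - w 0 := by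
  induction m with
  | zero => exact ⟨0, by simp⟩
  | succ m ih =>
    obtain ⟨s, hs, hpar, hcast⟩ := ih
    rw [abs_le] at hs
    rcases hw m with h | h
    · refine ⟨s + 1, by rw [abs_le]; push_cast; omega, by push_cast; omega, ?_⟩
      push_cast
      rw [hcast, ← h]
      ring
    · refine ⟨s - 1, by rw [abs_le]; push_cast; omega, by push_cast; omega, ?_⟩
      push_cast
      rw [hcast, sub_eq_add_neg _ (1 : ZMod p), ← h]
      ring

/-- The cycle `ℤ/p` has no closed walk of odd length less than `p`. -/
theorem walk_ne_of_odd {w : ℕ → ZMod p}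
    (hw : ∀ i, w (i + 1) - w i = 1 ∨ w (i + 1) - w i = -1) {m : ℕ} (hm : Odd m) (hmp : m < p) :
    w m ≠ w 0 := by
  intro h
  obtain ⟨s, hs, hpar, hcast⟩ := exists_lift_walk hw m
  rw [h, sub_self, ZMod.intCast_zmod_eq_zero_iff_dvd] at hcast
  -- The lift of a closed walk is a multiple of `p` of absolute value below `p`, hence 0; but it has
  -- the parity of the odd `m`.
  have h0 : s = 0 := Int.eq_zero_of_abs_lt_dvd hcast (by omega)
  obtain ⟨k, rfl⟩ := hm
  omega

theorem isCore_connCycle [Fact (1 < p)] (hodd : Odd p) : IsCore (addCayley (connCycle p)) := by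
  have hp : 1 < p := Fact.out
  have : NeZero p := ⟨by omega⟩
  refine isCore_addCayley isConnectionSet_connCycle fun f hf0 c hc hfc => ?_
  let g : ZMod p → ZMod p := fun x => f (fun _ => x) 0
  have hg : ∀ x, g (x + 1) - g x = 1 ∨ g (x + 1) - g x = -1 := by
    intro x
    have h : (addCayley (connCycle p)).Adj (fun _ => x + 1) (fun _ => x) := by
      rw [addCayley_adj_iff isConnectionSet_connCycle, mem_connCycle]
      simp
    have := f.map_adj h
    rwa [addCayley_adj_iff isConnectionSet_connCycle, mem_connCycle] at this
  have hc' : c = fun _ => c 0 := funext fun i => by rw [Subsingleton.elim i 0]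
  have hg0 : g 0 = 0 := congrFun hf0 0
  have hgc : g (c 0) = 0 := by
    change f (fun _ => c 0) 0 = 0
    rw [← hc', hfc]
    rfl
  have hval : (c 0).val ≠ 0 := by
    rw [Ne, ZMod.val_eq_zero]
    intro h
    apply hc
    rw [hc', h]
    rfl
  have hlt := ZMod.val_lt (c 0)
  -- As `p` is odd, one of the two arcs between 0 and `c` has odd length; its image is a closed walk
  -- of that length.
  rcases Nat.even_or_odd (c 0).val with h | h
  · refine walk_ne_of_odd (w := fun i => g (c 0 + i)) (fun i => ?_)
      (Nat.Odd.sub_even hlt.le hodd h) (by omega) ?_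
    · have := hg (c 0 + i)
      push_cast
      rwa [← add_assoc]
    · simp [Nat.cast_sub hlt.le, hg0, hgc]
  · refine walk_ne_of_odd (w := fun i => g i) (fun i => ?_) h hlt ?_
    · push_cast
      exact hg i
    · simp [hg0, hgc]

/-- Two steps add up to 0 or ±2, and ±2 is not ±1 because 1 and 3 are nonzero mod `p`. -/
theorem connCycle_triple (hp : 3 < p) {x y z : Fin 1 → ZMod p} (hxz : x ≠ z)
    (hxy : x - y ∈ connCycle p) (hyz : y - z ∈ connCycle p) : x - z ∉ connCycle p := by
  rw [mem_connCycle, Pi.sub_apply] at hxy hyz ⊢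
  have h1 : (1 : ZMod p) ≠ 0 := by
    have := Fact.mk (show 1 < p by omega)
    exact one_ne_zero
  have h3 : (3 : ZMod p) ≠ 0 := by
    intro h
    have := (ZMod.natCast_eq_zero_iff 3 p).mp (by exact_mod_cast h)
    exact absurd (Nat.le_of_dvd (by norm_num) this) (by omega)
  have hxz' : x 0 ≠ z 0 := fun h => hxz (funext fun i => by rw [Subsingleton.elim i 0, h])
  have hsum : x 0 - z 0 = (x 0 - y 0) + (y 0 - z 0) := by ring
  rw [hsum]
  rw [← sub_ne_zero, hsum] at hxz'
  rcases hxy with hxy | hxy <;> rcases hyz with hyz | hyz <;> rw [hxy, hyz] at hxz' ⊢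
  · rintro (h | h)
    · exact h1 (by linear_combination h)
    · exact h3 (by linear_combination h)
  · exact absurd (by ring) hxz'
  · exact absurd (by ring) hxz'
  · rintro (h | h)
    · exact h3 (by linear_combination -h)
    · exact h1 (by linear_combination -h)

/-- An endomorphism of the complement of an odd cycle that misses a vertex would cover the cycle
by fewer than `p / 2` edges. -/
theorem isCore_compl_connCycle (hp : 3 < p) (hodd : Odd p) :
    IsCore (addCayley (connCycle p))ᶜ := by
  have : NeZero p := ⟨by omega⟩
  have := Fact.mk (show 1 < p by omega)
  refine isCore_of_forall_injective fun f => Finite.injective_iff_surjective.mpr fun v => ?_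
  by_contra hv
  push Not at hv
  let d : (Fin 1 → ZMod p) → ℕ := fun x => (f x 0 - v 0).val
  have hd0 : ∀ x, d x ≠ 0 := by
    intro x h
    rw [ZMod.val_eq_zero, sub_eq_zero] at h
    exact hv x (funext fun i => by rw [Subsingleton.elim i 0, h])
  have hdp : ∀ x, d x < p := fun x => ZMod.val_lt _
  have hcast : ∀ x, (d x : ZMod p) = f x 0 - v 0 := fun x => ZMod.natCast_zmod_val _
  -- The nonzero offsets from the missed vertex `v` are paired as {1, 2}, {3, 4}, …. The values in a
  -- pair are nonadjacent in the complement, so distinct vertices mapped into it are adjacent in the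
  -- cycle.
  have hclass : ∀ x y, (d x - 1) / 2 = (d y - 1) / 2 → x ≠ y → x - y ∈ connCycle p := by
    intro x y hxy hne
    by_contra hmem
    have hadj : (addCayley (connCycle p))ᶜ.Adj x y := by
      rw [compl_adj, addCayley_adj_iff isConnectionSet_connCycle]
      exact ⟨hne, hmem⟩
    have h := f.map_adj hadj
    rw [compl_adj, addCayley_adj_iff isConnectionSet_connCycle, mem_connCycle, Pi.sub_apply] at h
    have hsub : f x 0 - f y 0 = d x - d y := by rw [hcast, hcast]; ring
    have hx := hd0 x
    have hy := hd0 y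
    rcases (by omega : d x = d y ∨ d x = d y + 1 ∨ d y = d x + 1) with h' | h' | h'
    · rw [h', sub_self, sub_eq_zero] at hsub
      exact h.1 (funext fun i => by rw [Subsingleton.elim i 0, hsub])
    · exact h.2 (Or.inl (by rw [hsub, h']; push_cast; ring))
    · exact h.2 (Or.inr (by rw [hsub, h']; push_cast; ring))
  -- Since `2 * ((p - 1) / 2) < p`, some pair receives three vertices, which would form a triangle
  -- in the cycle.
  obtain ⟨k, -, hk⟩ := Finset.exists_lt_card_fiber_of_mul_lt_card_of_maps_to
    (s := (Finset.univ : Finset (Fin 1 → ZMod p))) (t := Finset.range ((p - 1) / 2))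
    (f := fun x => (d x - 1) / 2) (n := 2)
    (fun x _ => by
      have := hd0 x
      have := hdp x
      obtain ⟨m, rfl⟩ := hodd
      rw [Finset.mem_range]
      omega)
    (by
      rw [Finset.card_range, Finset.card_univ, Fintype.card_fun, ZMod.card, Fintype.card_fin,
        pow_one]
      omega)
  obtain ⟨x, y, z, hx, hy, hz, hxy, hxz, hyz⟩ := Finset.two_lt_card_iff.mp hk
  simp only [Finset.mem_filter, Finset.mem_univ, true_and] at hx hy hz
  exact connCycle_triple hp hxz (hclass x y (hx.trans hy.symm) hxy)
    (hclass y z (hy.trans hz.symm) hyz) (hclass x z (hx.trans hz.symm) hxz)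

theorem isSharpExample_cycle [Fact p.Prime] (hp : 5 ≤ p) : IsSharpExample p 1 (connCycle p) := by
  have := Fact.mk (show 1 < p by omega)
  have hodd : Odd p := (Fact.out : p.Prime).odd_of_ne_two (by omega)
  have h2 : ∀ m : ℕ, 0 < m → m < p → (m : ZMod p) ≠ 0 := fun m hm hmp h =>
    absurd (Nat.le_of_dvd hm ((ZMod.natCast_eq_zero_iff m p).mp h)) (by omega)
  refine isSharpExample_of_isCore (a := fun _ => 1) (b := fun _ => 2) isConnectionSet_connCycle
    ?_ (mem_connCycle.mpr (Or.inl rfl)) ?_ ?_ (isCore_connCycle hodd)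
    (isCore_compl_connCycle (by omega) hodd)
  · rw [ncard_connCycle (by omega), kappa, if_neg (by omega), if_neg (by omega)]
  · intro h
    exact h2 2 (by omega) (by omega) (by exact_mod_cast congrFun h 0)
  · rw [mem_connCycle]
    rintro (h | h)
    · exact one_ne_zero (α := ZMod p) (by linear_combination h)
    · exact h2 3 (by omega) (by omega) (by push_cast; linear_combination h)

theorem nonempty_iso_cycleGraph (hp : 1 < p) :
    Nonempty (addCayley (connCycle p) ≃g cycleGraph p) := by
  have := Fact.mk hp
  -- With `p = n + 1`, `ZMod p` unfolds to `Fin (n + 1)`, the vertex type of `cycleGraph`.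
  obtain ⟨n, rfl⟩ : ∃ n, p = n + 1 := ⟨p - 1, by omega⟩
  refine ⟨⟨(Equiv.funUnique (Fin 1) (ZMod (n + 1)) :), fun {x y} => ?_⟩⟩
  rw [addCayley_adj_iff isConnectionSet_connCycle, mem_connCycle, cycleGraph_eq_circulantGraph]
  change (x 0 ≠ y 0 ∧ (x 0 - y 0 = (1 : ZMod (n + 1)) ∨ y 0 - x 0 = (1 : ZMod (n + 1)))) ↔ _
  rw [Pi.sub_apply, ← neg_eq_iff_eq_neg, neg_sub, and_iff_right_of_imp]
  rintro (h | h) heq <;> simp [heq] at h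

end Cycle

end PAryCayley

theorem mainTheorem3 :
    -- for each prime there is an example
    (∀ (p : ℕ) [Fact p.Prime], ∃ (d : ℕ) (C : Set (Fin d → ZMod p)),
      PAryCayley.IsSharpExample p d C) ∧
    -- the example for `p = 2`
    (PAryCayley.IsSharpExample 2 4 PAryCayley.connTwo ∧
      Nonempty (SimpleGraph.addCayley PAryCayley.connTwo ≃g PAryCayley.foldedCube 5) ∧
      Nonempty ((SimpleGraph.addCayley PAryCayley.connTwo)ᶜ ≃g PAryCayley.halvedCube 5)) ∧
    -- the example for `p = 3`
    PAryCayley.IsSharpExample 3 3 PAryCayley.connThree ∧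
    -- the examples for `p ≥ 5`
    (∀ (p : ℕ) [Fact p.Prime], 5 ≤ p →
      PAryCayley.IsSharpExample p 1 (PAryCayley.connCycle p) ∧
      Nonempty (SimpleGraph.addCayley (PAryCayley.connCycle p) ≃g SimpleGraph.cycleGraph p) ∧
      Nonempty ((SimpleGraph.addCayley (PAryCayley.connCycle p))ᶜ ≃g
        (SimpleGraph.cycleGraph p)ᶜ)) := by
  refine ⟨fun p hp => ?_, ⟨PAryCayley.isSharpExample_two, PAryCayley.nonempty_iso_foldedCube,
    PAryCayley.nonempty_iso_halvedCube⟩, PAryCayley.isSharpExample_three, fun p _ hp => ?_⟩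
  · rcases lt_or_ge p 5 with h | h
    · have hprime := hp.out
      interval_cases p
      · exact absurd hprime (by norm_num)
      · exact absurd hprime (by norm_num)
      · exact ⟨4, _, PAryCayley.isSharpExample_two⟩
      · exact ⟨3, _, PAryCayley.isSharpExample_three⟩
      · exact absurd hprime (by norm_num)
    · exact ⟨1, _, PAryCayley.isSharpExample_cycle h⟩
  · obtain ⟨φ⟩ := PAryCayley.nonempty_iso_cycleGraph (show 1 < p by omega)
    exact ⟨PAryCayley.isSharpExample_cycle hp, ⟨φ⟩,
      ⟨⟨φ.toEquiv, fun {x y} => by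
        rw [SimpleGraph.compl_adj, SimpleGraph.compl_adj]
        exact and_congr φ.toEquiv.injective.ne_iff (not_congr φ.map_adj_iff)⟩⟩⟩
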